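/- Let $d\ge 2$. For a lattice $\Lambda\subset\mathbb R^d$ let $\Lambda^*=\{y\in\mathbb R^d:\langle y,x\rangle\in\mathbb Z\text{ for each }x\in\Lambda\}$ be its dual lattice. For $\tau=(\tau_1,\dots,\tau_d)\in\mathbb R^d$ with $\tau_1+\dots+\tau_d=0$ put $\mathcal B_\tau=\{x\in\mathbb R^d:|x_i|\le e^{\tau_i},\ i=1,\dots,d\}$. For $1\le k\le d$ let $\lambda_k(\mathcal B_\tau,\Lambda)$ be the $k$-th successive minimum, i.e. the infimum of positive $\lambda$ such that $\lambda\mathcal B_\tau$ contains at least $k$ linearly independent vectors of $\Lambda$, and let $L_k(\tau,\Lambda)=\log\lambda_k(\mathcal B_\tau,\Lambda)$, $S_k(\tau,\Lambda)=\sum_{1\le j\le k}L_j(\tau,\Lambda)$. Then there is a constant $C$, depending only on $d$, such that for every lattice $\Lambda\subset\mathbb R^d$ of covolume $1$ and every $\tau\in\mathbb R^d$ with $\tau_1+\dots+\tau_d=0$, $$S_1(\tau,\Lambda)\le\frac{S_1(-\tau,\Lambda^*)}{d-1}+C.$$ -/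

import Mathlib

open scoped Pointwise Matrix

noncomputable section

/-- The dual of a lattice `Λ` in `ℝ^d` with respect to the standard inner product:
all `y` with `⟨y, x⟩ ∈ ℤ` for each `x ∈ Λ`. -/
def dualLattice {d : ℕ} (Λ : Submodule ℤ (Fin d → ℝ)) : Submodule ℤ (Fin d → ℝ) :=
  LinearMap.BilinForm.dualSubmodule (dotProductBilin ℝ ℝ) Λ

theorem mem_dualLattice {d : ℕ} {Λ : Submodule ℤ (Fin d → ℝ)} {y : Fin d → ℝ} :
    y ∈ dualLattice Λ ↔ ∀ x ∈ Λ, ∃ n : ℤ, (n : ℝ) = y ⬝ᵥ x := by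
  simp [dualLattice, LinearMap.BilinForm.mem_dualSubmodule, Submodule.mem_one]

/-- The box `D_τ 𝓑`, where `𝓑` is the closed unit ball of the sup-norm on `ℝ^d` (the norm of the
type `Fin d → ℝ`) and `D_τ = diag(e^{τ_1}, …, e^{τ_d})`. -/
def box {d : ℕ} (τ : Fin d → ℝ) : Set (Fin d → ℝ) :=
  (fun x => Matrix.diagonal (fun i => Real.exp (τ i)) *ᵥ x) '' Metric.closedBall 0 1

theorem mem_box {d : ℕ} {τ x : Fin d → ℝ} :
    x ∈ box τ ↔ ∀ i, |x i| ≤ Real.exp (τ i) := by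
  simp only [box, Set.mem_image, mem_closedBall_zero_iff]
  constructor
  · rintro ⟨y, hy, rfl⟩ i
    have h : |y i| ≤ 1 := (norm_le_pi_norm y i).trans hy
    rw [Matrix.mulVec_diagonal, abs_mul, Real.abs_exp]
    exact mul_le_of_le_one_right (Real.exp_pos _).le h
  · intro h
    refine ⟨fun i => Real.exp (-τ i) * x i, ?_, ?_⟩
    · refine (pi_norm_le_iff_of_nonneg zero_le_one).2 fun i => ?_
      rw [Real.norm_eq_abs, abs_mul, Real.abs_exp, Real.exp_neg, inv_mul_le_iff₀ (Real.exp_pos _),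
        mul_one]
      exact h i
    · ext i
      rw [Matrix.mulVec_diagonal, ← mul_assoc, ← Real.exp_add, add_neg_cancel, Real.exp_zero,
        one_mul]

/-- The `k`-th successive minimum of a set `M` with respect to `Λ`: the infimum of positive `r`
such that `r • M` contains at least `k` linearly independent vectors of `Λ`. -/
def successiveMin {d : ℕ} (k : ℕ) (M : Set (Fin d → ℝ)) (Λ : Submodule ℤ (Fin d → ℝ)) : ℝ :=
  sInf {r : ℝ | 0 < r ∧ ∃ v : Fin k → (Fin d → ℝ),
    (∀ i, v i ∈ Λ ∧ v i ∈ r • M) ∧ LinearIndependent ℝ v}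

/-- `L_k(τ, Λ) = log λ_k(𝓑_τ, Λ)`. -/
def logMin {d : ℕ} (k : ℕ) (τ : Fin d → ℝ) (Λ : Submodule ℤ (Fin d → ℝ)) : ℝ :=
  Real.log (successiveMin k (box τ) Λ)

/-- `S_k(τ, Λ) = L_1(τ, Λ) + ⋯ + L_k(τ, Λ)`. -/
def logMinSum {d : ℕ} (k : ℕ) (τ : Fin d → ℝ) (Λ : Submodule ℤ (Fin d → ℝ)) : ℝ :=
  ∑ j ∈ Finset.Icc 1 k, logMin j τ Λ

end

/-! Let `v` be a nonzero dual vector with all `|v j| * exp (τ j) ≤ r`, and let `i` maximise this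
quantity. Minkowski's theorem is applied to the form `v ⬝ᵥ x`, with bound `1`, and the forms `exp
(-τ j) * x j` for `j ≠ i`, with bound `R`; their determinant is at most `r < R ^ (d - 1)` in
absolute value. The integer `v ⬝ᵥ x` then vanishes, and this relation bounds the remaining
coordinate `x i`, so the first minimum of `Λ` is at most `d * R`. Hence `(l / d) ^ (d - 1) ≤ m` for
the first minima `l` of `Λ` and `m` of its dual; taking logarithms gives `C = log d`. The core is
`successiveMin_one_box_le_of_mem_dualLattice`. -/

open MeasureTheory in
/-- Minkowski's linear forms theorem with strict inequalities, for a lattice of covolume `1`. -/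
theorem exists_mem_lattice_abs_mulVec_lt {ι : Type*} [Fintype ι] [DecidableEq ι]
    (Λ : Submodule ℤ (ι → ℝ)) [DiscreteTopology Λ] [IsZLattice ℝ Λ]
    (hΛ : ZLattice.covolume Λ = 1) (A : Matrix ι ι ℝ) (hA : A.det ≠ 0) (c : ι → ℝ)
    (hc : ∀ i, 0 < c i) (h : |A.det| < ∏ i, c i) :
    ∃ x ∈ Λ, x ≠ 0 ∧ ∀ i, |(A *ᵥ x) i| < c i := by
  set f : (ι → ℝ) →ₗ[ℝ] (ι → ℝ) := Matrix.toLin' A with hf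
  have hdet : LinearMap.det f = A.det := LinearMap.det_toLin' A
  set K : Set (ι → ℝ) := Set.univ.pi fun i => Metric.ball (0 : ℝ) (c i) with hK
  have hKmem (x : ι → ℝ) : x ∈ f ⁻¹' K ↔ ∀ i, |(A *ᵥ x) i| < c i := by
    simp [hK, hf, Set.mem_pi]
  have hKvol : volume K = ENNReal.ofReal (2 ^ Fintype.card ι * ∏ i, c i) := by
    rw [hK, volume_pi_pi]
    simp only [Real.volume_ball]
    rw [← ENNReal.ofReal_prod_of_nonneg fun i _ => by have := hc i; positivity,
      Finset.prod_mul_distrib]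
    simp
  let b := Module.Free.chooseBasis ℤ Λ
  have fund := ZLattice.isAddFundamentalDomain b volume
  have hF : volume (ZSpan.fundamentalDomain (b.ofZLatticeBasis ℝ)) = 1 := by
    have h1 := ZLattice.covolume_eq_measure_fundamentalDomain Λ volume fund
    rw [hΛ] at h1
    exact ((ENNReal.toReal_eq_one_iff _).1 h1.symm)
  have hvol : volume (f ⁻¹' K) = ENNReal.ofReal (|A.det|⁻¹ * (2 ^ Fintype.card ι * ∏ i, c i)) := by
    rw [Measure.addHaar_preimage_linearMap _ (hdet ▸ hA), hKvol, hdet, abs_inv,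
      ENNReal.ofReal_mul (inv_nonneg.2 (abs_nonneg A.det))]
  have hlt : volume (ZSpan.fundamentalDomain (b.ofZLatticeBasis ℝ)) *
      2 ^ Module.finrank ℝ (ι → ℝ) < volume (f ⁻¹' K) := by
    have h2 : (2 : ENNReal) ^ Fintype.card ι = ENNReal.ofReal (2 ^ Fintype.card ι) := by
      rw [ENNReal.ofReal_pow zero_le_two, ENNReal.ofReal_ofNat]
    have hpos : 0 < |A.det| := abs_pos.2 hA
    have hprod : 0 < ∏ i, c i := Finset.prod_pos fun i _ => hc i
    rw [hF, one_mul, hvol, Module.finrank_fintype_fun_eq_card, h2,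
      ENNReal.ofReal_lt_ofReal_iff (by positivity), lt_inv_mul_iff₀ hpos, mul_comm]
    gcongr
  have : Countable Λ.toAddSubgroup := inferInstanceAs (Countable Λ)
  obtain ⟨x, hx0, hx⟩ := exists_ne_zero_mem_lattice_of_measure_mul_two_pow_lt_measure
    (L := Λ.toAddSubgroup) (s := f ⁻¹' K) fund
    (fun x hx => by
      rw [hKmem] at hx ⊢
      intro i
      rw [Matrix.mulVec_neg, Pi.neg_apply, abs_neg]
      exact hx i)
    ((convex_pi fun i _ => convex_ball 0 (c i)).linear_preimage f) hlt
  exact ⟨x, x.2, by simpa using hx0, (hKmem _).1 hx⟩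

theorem mem_smul_box {d : ℕ} {τ x : Fin d → ℝ} {r : ℝ} (hr : 0 < r) :
    x ∈ r • box τ ↔ ∀ i, |x i| ≤ r * Real.exp (τ i) := by
  rw [Set.mem_smul_set_iff_inv_smul_mem₀ hr.ne', mem_box]
  refine forall_congr' fun i => ?_
  rw [Pi.smul_apply, smul_eq_mul, abs_mul, abs_of_pos (inv_pos.2 hr), inv_mul_le_iff₀ hr]

/-- The values over which the infimum in `successiveMin 1 (box τ) Λ` is taken. -/
theorem successiveMin_one_box {d : ℕ} (τ : Fin d → ℝ) (Λ : Submodule ℤ (Fin d → ℝ)) :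
    successiveMin 1 (box τ) Λ =
      sInf {r : ℝ | 0 < r ∧ ∃ x ∈ Λ, x ≠ 0 ∧ ∀ i, |x i| ≤ r * Real.exp (τ i)} := by
  unfold successiveMin
  congr 1
  ext r
  refine and_congr_right fun hr => ⟨?_, ?_⟩
  · rintro ⟨v, hv, hli⟩
    exact ⟨v 0, (hv 0).1, hli.ne_zero 0, (mem_smul_box hr).1 (hv 0).2⟩
  · rintro ⟨x, hx, hx0, h⟩
    exact ⟨fun _ => x, fun _ => ⟨hx, (mem_smul_box hr).2 h⟩, .of_subsingleton 0 hx0⟩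

theorem successiveMin_one_box_le {d : ℕ} {τ x : Fin d → ℝ} {Λ : Submodule ℤ (Fin d → ℝ)} {r : ℝ}
    (hr : 0 < r) (hx : x ∈ Λ) (hx0 : x ≠ 0) (h : ∀ i, |x i| ≤ r * Real.exp (τ i)) :
    successiveMin 1 (box τ) Λ ≤ r := by
  rw [successiveMin_one_box]
  exact csInf_le ⟨0, fun s hs => hs.1.le⟩ ⟨hr, x, hx, hx0, h⟩

theorem exists_pos_forall_mem_box {d : ℕ} (τ : Fin d → ℝ) {x : Fin d → ℝ} :
    ∃ r : ℝ, 0 < r ∧ ∀ i, |x i| ≤ r * Real.exp (τ i) := by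
  have hs : ∀ i, 0 ≤ |x i| * Real.exp (-τ i) := fun i => by positivity
  refine ⟨∑ i, |x i| * Real.exp (-τ i) + 1,
    add_pos_of_nonneg_of_pos (Finset.sum_nonneg fun i _ => hs i) one_pos, fun i => ?_⟩
  calc |x i| = |x i| * Real.exp (-τ i) * Real.exp (τ i) := by
        rw [mul_assoc, ← Real.exp_add, neg_add_cancel, Real.exp_zero, mul_one]
    _ ≤ _ := by
        gcongr
        exact (Finset.single_le_sum (f := fun i => |x i| * Real.exp (-τ i))
          (fun i _ => hs i) (Finset.mem_univ i)).trans (le_add_of_nonneg_right zero_le_one)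

/-- A lower bound for the values defining the first minimum passes to the first minimum. -/
theorem le_successiveMin_one_box {d : ℕ} {τ : Fin d → ℝ} {Λ : Submodule ℤ (Fin d → ℝ)} {a : ℝ}
    (hΛ : Λ ≠ ⊥)
    (h : ∀ r > 0, ∀ x ∈ Λ, x ≠ 0 → (∀ i, |x i| ≤ r * Real.exp (τ i)) → a ≤ r) :
    a ≤ successiveMin 1 (box τ) Λ := by
  rw [successiveMin_one_box]
  obtain ⟨x, hx, hx0⟩ := Λ.exists_mem_ne_zero_of_ne_bot hΛ
  obtain ⟨r, hr, hrx⟩ := exists_pos_forall_mem_box τ (x := x)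
  exact le_csInf ⟨r, hr, x, hx, hx0, hrx⟩ fun s ⟨hs, y, hy, hy0, hsy⟩ => h s hs y hy hy0 hsy

/-- By discreteness, some ball around `0` contains no other lattice point. Positivity is what makes
the logarithm of the minimum meaningful. -/
theorem successiveMin_one_box_pos {d : ℕ} (τ : Fin d → ℝ) (Λ : Submodule ℤ (Fin d → ℝ))
    [DiscreteTopology Λ] (hΛ : Λ ≠ ⊥) : 0 < successiveMin 1 (box τ) Λ := by
  obtain ⟨ε, hε, hball⟩ := Metric.exists_ball_inter_eq_singleton_of_mem_discrete
    (s := (Λ : Set (Fin d → ℝ))) ⟨‹_›⟩ Λ.zero_mem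
  have hMi (i) : Real.exp (τ i) ≤ ∑ j, Real.exp (τ j) :=
    Finset.single_le_sum (f := fun j => Real.exp (τ j)) (fun j _ => (Real.exp_pos _).le)
      (Finset.mem_univ i)
  set M := ∑ j, Real.exp (τ j)
  have hM : 0 ≤ M := Finset.sum_nonneg fun j _ => (Real.exp_pos _).le
  have hM1 : 0 < M + 1 := by positivity
  refine (div_pos hε hM1).trans_le (le_successiveMin_one_box hΛ fun r hr x hx hx0 hrx => ?_)
  by_contra! hlt
  rw [lt_div_iff₀ hM1] at hlt
  refine hx0 (Set.mem_singleton_iff.1 (hball ▸ ⟨?_, hx⟩))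
  rw [mem_ball_zero_iff]
  refine ((pi_norm_le_iff_of_nonneg (by positivity)).2 fun i => ?_).trans_lt hlt
  exact (hrx i).trans (by gcongr; exact (hMi i).trans (by simp))

theorem IsZLattice.ne_bot {d : ℕ} [NeZero d] (Λ : Submodule ℤ (Fin d → ℝ))
    [DiscreteTopology Λ] [IsZLattice ℝ Λ] : Λ ≠ ⊥ := by
  rintro rfl
  have h := IsZLattice.span_top (K := ℝ) (L := (⊥ : Submodule ℤ (Fin d → ℝ)))
  simp at h

/-- A coordinate functional of a lattice basis is integral on `Λ`. This rules out the junk value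
`sInf ∅ = 0` for the dual minimum. -/
theorem dualLattice_ne_bot {d : ℕ} [NeZero d] (Λ : Submodule ℤ (Fin d → ℝ))
    [DiscreteTopology Λ] [IsZLattice ℝ Λ] : dualLattice Λ ≠ ⊥ := by
  let b := Module.Free.chooseBasis ℤ Λ
  let B := b.ofZLatticeBasis ℝ
  obtain ⟨i⟩ : Nonempty (Module.Free.ChooseBasisIndex ℤ Λ) := B.index_nonempty
  set y := (dotProductEquiv ℝ (Fin d)).symm (B.coord i)
  have hy (x) : y ⬝ᵥ x = B.coord i x :=
    DFunLike.congr_fun ((dotProductEquiv ℝ (Fin d)).apply_symm_apply (B.coord i)) x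
  refine (Submodule.ne_bot_iff _).2 ⟨y, mem_dualLattice.2 fun x hx => ⟨b.repr ⟨x, hx⟩ i, ?_⟩, ?_⟩
  · rw [hy, Module.Basis.coord_apply]
    exact (b.ofZLatticeBasis_repr_apply ℝ Λ ⟨x, hx⟩ i).symm
  · intro h0
    have := hy (B i)
    simp [h0] at this

/-- A dual vector `v` whose rescaled coordinates are at most `r` yields a lattice vector in the
hyperplane orthogonal to `v` whose rescaled coordinates are at most a multiple of
`r ^ (1 / (d - 1))`. -/
theorem successiveMin_one_box_le_of_mem_dualLattice {d : ℕ} (hd : 2 ≤ d)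
    (Λ : Submodule ℤ (Fin d → ℝ)) [DiscreteTopology Λ] [IsZLattice ℝ Λ]
    (hΛ : ZLattice.covolume Λ = 1) {τ : Fin d → ℝ} (hτ : ∑ i, τ i = 0) {v : Fin d → ℝ}
    (hv : v ∈ dualLattice Λ) (hv0 : v ≠ 0) {r R : ℝ}
    (hR : 0 < R) (hvr : ∀ i, |v i| ≤ r * Real.exp (-τ i)) (hrR : r < R ^ (d - 1)) :
    successiveMin 1 (box τ) Λ ≤ d * R := by
  have : NeZero d := ⟨by omega⟩
  -- Maximality makes `v i` nonzero and lets `x i` be recovered from `v ⬝ᵥ x = 0` at the cost of a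
  -- factor depending only on `d`.
  obtain ⟨i, hi⟩ := Finite.exists_max fun j => |v j| * Real.exp (τ j)
  have hvi : 0 < |v i| := by
    obtain ⟨j, hj⟩ := Function.ne_iff.1 hv0
    refine pos_of_mul_pos_left ((mul_pos (abs_pos.2 hj) (Real.exp_pos (τ j))).trans_le (hi j))
      (Real.exp_pos _).le
  have hir : |v i| * Real.exp (τ i) ≤ r := by
    have := mul_le_mul_of_nonneg_right (hvr i) (Real.exp_pos (τ i)).le
    rwa [mul_assoc, ← Real.exp_add, neg_add_cancel, Real.exp_zero, mul_one] at this
  set A := (Matrix.diagonal fun j => Real.exp (-τ j)).updateRow i v with hA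
  have hdet : A.det = v i * Real.exp (τ i) := by
    -- Expanding `v` in the rows of the diagonal matrix, only the `i`-th coefficient contributes,
    -- and the diagonal determinant is `1` since `∑ τ = 0`.
    have hv' : v = ∑ j, (v j * Real.exp (τ j)) •
        (Matrix.diagonal fun j => Real.exp (-τ j) : Matrix (Fin d) (Fin d) ℝ) j := by
      ext k
      simp [Matrix.diagonal_apply, Finset.sum_apply, mul_assoc, ← Real.exp_add]
    rw [hA, hv', Matrix.det_updateRow_sum, ← hv', Matrix.det_diagonal, ← Real.exp_sum]
    simp [hτ]
  have hAi (x : Fin d → ℝ) : (A *ᵥ x) i = v ⬝ᵥ x := by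
    simp [hA, Matrix.mulVec]
  have hAj (x : Fin d → ℝ) (j) (hj : j ≠ i) : (A *ᵥ x) j = Real.exp (-τ j) * x j := by
    simp [hA, Matrix.mulVec, Matrix.updateRow_ne hj, Matrix.diagonal_apply, dotProduct]
  have hvi0 : v i ≠ 0 := abs_pos.1 hvi
  obtain ⟨x, hx, hx0, hAx⟩ := exists_mem_lattice_abs_mulVec_lt Λ hΛ A
    (by rw [hdet]; exact mul_ne_zero hvi0 (Real.exp_ne_zero _))
    (Function.update (fun _ => R) i 1)
    (fun j => by rcases eq_or_ne j i with rfl | hj <;> simp [*])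
    (by
      rw [Finset.prod_update_of_mem (Finset.mem_univ i), hdet, abs_mul, Real.abs_exp]
      simpa [Finset.card_sdiff] using hir.trans_lt hrR)
  have hxv : v ⬝ᵥ x = 0 := by
    obtain ⟨n, hn⟩ := mem_dualLattice.1 hv x hx
    have h1 := hAx i
    rw [hAi, ← hn, Function.update_self] at h1
    have : |n| < 1 := by exact_mod_cast h1
    rw [← hn, Int.abs_lt_one_iff.1 this, Int.cast_zero]
  have hxj (j) (hj : j ≠ i) : |x j| ≤ R * Real.exp (τ j) := by
    have h1 := (hAx j).le
    rwa [hAj x j hj, Function.update_of_ne hj, abs_mul, Real.abs_exp, Real.exp_neg,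
      inv_mul_le_iff₀ (Real.exp_pos _), mul_comm] at h1
  have hd1 : (1 : ℝ) ≤ d := by exact_mod_cast (by omega : 1 ≤ d)
  refine successiveMin_one_box_le (by positivity) hx hx0 fun j => ?_
  rcases ne_or_eq j i with hj | rfl
  · refine (hxj j hj).trans ?_
    gcongr
    exact le_mul_of_one_le_left hR.le hd1
  -- Here `j` is the maximising index; its coordinate is found from orthogonality to `v`.
  · have hsum : v j * x j = -∑ k ∈ Finset.univ.erase j, v k * x k := by
      rw [eq_neg_iff_add_eq_zero, Finset.add_sum_erase _ (fun k => v k * x k) (Finset.mem_univ j)]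
      exact hxv
    have hle : |v j| * |x j| ≤ |v j| * (d * R * Real.exp (τ j)) := by
      calc |v j| * |x j| = |∑ k ∈ Finset.univ.erase j, v k * x k| := by
            rw [← abs_mul, hsum, abs_neg]
        _ ≤ ∑ k ∈ Finset.univ.erase j, |v k * x k| := Finset.abs_sum_le_sum_abs _ _
        _ ≤ ∑ k ∈ Finset.univ.erase j, R * (|v j| * Real.exp (τ j)) := by
            refine Finset.sum_le_sum fun k hk => ?_
            rw [abs_mul]
            calc |v k| * |x k| ≤ |v k| * (R * Real.exp (τ k)) := by
                  gcongr
                  exact hxj k (Finset.ne_of_mem_erase hk)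
              _ = R * (|v k| * Real.exp (τ k)) := by ring
              _ ≤ _ := by
                  gcongr R * ?_
                  exact hi k
        _ ≤ ∑ k : Fin d, R * (|v j| * Real.exp (τ j)) :=
            Finset.sum_le_sum_of_subset_of_nonneg (Finset.erase_subset _ _)
              fun _ _ _ => by positivity
        _ = |v j| * (d * R * Real.exp (τ j)) := by
            simp
            ring
    exact le_of_mul_le_mul_left hle hvi

theorem theoremt (d : ℕ) (hd : 2 ≤ d) :
    ∃ C : ℝ, ∀ (Λ : Submodule ℤ (Fin d → ℝ)) [DiscreteTopology Λ] [IsZLattice ℝ Λ],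
      ZLattice.covolume Λ = 1 →
      ∀ τ : Fin d → ℝ, ∑ i, τ i = 0 →
        logMinSum 1 τ Λ ≤ logMinSum 1 (-τ) (dualLattice Λ) / ((d : ℝ) - 1) + C := by
  refine ⟨Real.log d, fun Λ _ _ hΛ τ hτ => ?_⟩
  have : NeZero d := ⟨by omega⟩
  have hd0 : (0 : ℝ) < d := by exact_mod_cast (by omega : 0 < d)
  have hd1 : (0 : ℝ) < (d : ℝ) - 1 := by
    have : (2 : ℝ) ≤ d := by exact_mod_cast hd
    linarith
  have hpos := successiveMin_one_box_pos τ Λ (IsZLattice.ne_bot Λ)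
  simp only [logMinSum, logMin, Finset.Icc_self, Finset.sum_singleton]
  set l := successiveMin 1 (box τ) Λ with hl
  set m := successiveMin 1 (box (-τ)) (dualLattice Λ)
  have hlm : (l / d) ^ (d - 1) ≤ m := by
    refine le_successiveMin_one_box (dualLattice_ne_bot Λ) fun r hr v hv hv0 hvr => ?_
    by_contra! hlt
    -- The strict form of Minkowski's theorem needs `r < R ^ (d - 1)`; continuity of the power
    -- leaves room for such an `R` below `l / d`.
    obtain ⟨R, hR, hRl, hrR⟩ : ∃ R, 0 < R ∧ R < l / d ∧ r < R ^ (d - 1) := by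
      have hcont : Filter.Tendsto (fun R : ℝ => R ^ (d - 1)) (nhdsWithin (l / d) (Set.Iio (l / d)))
          (nhds ((l / d) ^ (d - 1))) :=
        ((continuous_pow (d - 1)).tendsto (l / d)).mono_left nhdsWithin_le_nhds
      obtain ⟨R, h1, h2⟩ := ((hcont.eventually (lt_mem_nhds hlt)).and
        (Ioo_mem_nhdsLT (div_pos hpos hd0))).exists
      exact ⟨R, h2.1, h2.2, h1⟩
    have h1 := successiveMin_one_box_le_of_mem_dualLattice hd Λ hΛ hτ hv hv0 hR hvr hrR
    rw [lt_div_iff₀' hd0] at hRl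
    exact (h1.trans_lt hRl).false
  have hlog := Real.log_le_log (by positivity) hlm
  rw [Real.log_pow, Real.log_div hpos.ne' hd0.ne', Nat.cast_sub (by omega), Nat.cast_one,
    ← le_div_iff₀' hd1] at hlog
  linarith
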